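/- Let $Z$ be a random vector with a nondegenerate distribution, let $\alpha_{10},\alpha_{20}\in(0,1)$ be fixed, let $\pi$ be a measurable function with values in $[0,1]$, and let $D_{(1)},D_{(2)}$ be $\{0,1\}$-valued random variables that are conditionally independent given $Z$ and satisfy $E(D_{(1)}\mid Z)=E(D_{(1)})=\alpha_{10}$, $E(D_{(2)}\mid Z)=\pi(Z)$ and $\alpha_{20}=E(D_{(2)})=E\{\pi(Z)\}$. Let $(Z_i,D_{i1},D_{i2})$, $i=1,2,\ldots$, be i.i.d. copies of $(Z,D_{(1)},D_{(2)})$, put $D_i=I(D_{i1}+D_{i2}>0)$ and $\varphi(z)=1-(1-\alpha_{10})\{1-\pi(z)\}$ (so that $\varphi(Z)$ is the conditional probability given $Z$ of being sampled in at least one of the two captures). Let $\ell(z,\theta)$, $\theta\in\mathbb{R}^q$, be a loss function, measurable in $z$ and convex in $\theta$, let $\theta_0$ be a minimizer of the risk $R(\theta)=E\{\ell(Z,\theta)\}$, with $R(\theta_0)$ finite, and let $\dot\ell(z)=\partial\ell(z,\theta_0)/\partial\theta$, which is assumed to exist for almost every $z$ under the distribution of $Z$. For $t$ in a neighborhood of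 $0$ write $$\ell(z,\theta_0+t)=\ell(z,\theta_0)+\dot\ell(z)^{\top}t+\xi(z,t).$$ Suppose that $E\{\dot\ell(Z)\}=0$, that the matrix $B_{\dot\ell\dot\ell}=E\{\dot\ell(Z)\dot\ell(Z)^{\top}/\varphi(Z)\}$ is finite, that $\xi(Z,t)$ is square-integrable for all $t$ near $0$, and that for some symmetric positive-definite matrix $V$, as $\|t\|\to0$, $$E\{\xi(Z,t)\}=\tfrac12 t^{\top}Vt+o(\|t\|^2),\qquad E\{\xi^2(Z,t)\}=o(\|t\|^2).$$ For every $N$ let $\hat\theta_{\rm IPW}$ be a random vector that almost surely minimizes $$\hat R_{\rm IPW}(\theta)=\frac1N\sum_{i=1}^N\frac{D_i}{\varphi(Z_i)}\,\ell(Z_i,\theta)$$ over $\theta\in\mathbb{R}^q$ whenever a minimizer exists (its value is arbitrary when there is none). Then, as $N\to\infty$, $$\sqrt N\,(\hat\theta_{\rm IPW}-\theta_0)\overset{d}{\longrightarrow}\mathcal N\bigl(0,\;V^{-1}B_{\dot\ell\dot\ell}V^{-1}\bigr).$$ -/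

import Mathlib

open MeasureTheory ProbabilityTheory Filter Asymptotics
open scoped Topology Matrix BigOperators

noncomputable section

/-- A datum is sampled when it is caught in the first or in the second capture:
`D = I(D₁ + D₂ > 0)`. -/
def captured (d₁ d₂ : ℝ) : ℝ := if 0 < d₁ + d₂ then 1 else 0

/-- Overall probability of being sampled for a datum `z`:
`φ(z) = 1 - (1 - α₁₀) (1 - π(z))`. -/
def inclusionProb {S : Type*} (α₁₀ : ℝ) (π : S → ℝ) (z : S) : ℝ :=
  1 - (1 - α₁₀) * (1 - π z)

/-- Capture--recapture sampling of a generic datum `Z` (a random element of `S` on the probability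
space `(Ω', ν)`): the first capture has the constant probability `α₁₀`, the second one the
probability `π(Z)`, and, given `Z`, the two captures are independent Bernoulli experiments. -/
structure CaptureRecapture {S Ω' : Type*} [MeasurableSpace S] [mΩ' : MeasurableSpace Ω']
    (ν : Measure Ω') (Z : Ω' → S) (D₁ D₂ : Ω' → ℝ) (α₁₀ α₂₀ : ℝ) (π : S → ℝ) : Prop where
  measurable_Z : Measurable Z
  measurable_D₁ : Measurable D₁
  measurable_D₂ : Measurable D₂
  measurable_π : Measurable π
  /-- The captures are recorded by indicators. -/
  D₁_zero_or_one : ∀ᵐ ω ∂ν, D₁ ω = 0 ∨ D₁ ω = 1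
  D₂_zero_or_one : ∀ᵐ ω ∂ν, D₂ ω = 0 ∨ D₂ ω = 1
  π_mem : ∀ z, π z ∈ Set.Icc (0 : ℝ) 1
  /-- The distribution of `Z` is nondegenerate. -/
  nondegenerate : ∀ z, ¬ ∀ᵐ ω ∂ν, Z ω = z
  /-- `E(D₁ | Z) = E(D₁) = α₁₀`. -/
  condExp_D₁ : ν[D₁ | MeasurableSpace.comap Z inferInstance] =ᵐ[ν] fun _ => α₁₀
  integral_D₁ : ∫ ω, D₁ ω ∂ν = α₁₀
  /-- `E(D₂ | Z) = π(Z)`. -/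
  condExp_D₂ : ν[D₂ | MeasurableSpace.comap Z inferInstance] =ᵐ[ν] fun ω => π (Z ω)
  /-- `α₂₀ = E(D₂) = E(π(Z))`. -/
  integral_D₂ : ∫ ω, D₂ ω ∂ν = α₂₀
  integral_π : ∫ ω, π (Z ω) ∂ν = α₂₀
  /-- Conditional independence of the two captures given `Z`; for indicators it amounts to
  `E(D₁ D₂ | Z) = E(D₁ | Z) E(D₂ | Z)`. -/
  condExp_mul : ν[fun ω => D₁ ω * D₂ ω | MeasurableSpace.comap Z inferInstance] =ᵐ[ν]
    fun ω => (ν[D₁ | MeasurableSpace.comap Z inferInstance]) ω *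
      (ν[D₂ | MeasurableSpace.comap Z inferInstance]) ω

/-- The triples `(Zs i, D₁s i, D₂s i)`, `i = 0, 1, 2, …`, on `(Ω, μ)` are i.i.d. copies of
`(Z, D₁, D₂)` on `(Ω', ν)`. -/
structure IIDCopies {S Ω Ω' : Type*} [MeasurableSpace S] [MeasurableSpace Ω] [MeasurableSpace Ω']
    (μ : Measure Ω) (Zs : ℕ → Ω → S) (D₁s D₂s : ℕ → Ω → ℝ)
    (ν : Measure Ω') (Z : Ω' → S) (D₁ D₂ : Ω' → ℝ) : Prop where
  indep : iIndepFun (fun i ω => (Zs i ω, D₁s i ω, D₂s i ω)) μ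
  identDistrib : ∀ i, IdentDistrib (fun ω => (Zs i ω, D₁s i ω, D₂s i ω))
    (fun ω => (Z ω, D₁ ω, D₂ ω)) μ ν

/-- `θ₀` minimizes the risk `R(θ) = E(ℓ(Z, θ))`. The minimal risk is finite; parameters of
nonintegrable loss are not compared with `θ₀`. -/
def IsRiskMinimizer {S Ω' : Type*} {q : ℕ} [MeasurableSpace Ω'] (ν : Measure Ω') (Z : Ω' → S)
    (ℓ : S → EuclideanSpace ℝ (Fin q) → ℝ) (θ₀ : EuclideanSpace ℝ (Fin q)) : Prop :=
  Integrable (fun ω => ℓ (Z ω) θ₀) ν ∧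
    ∀ θ, Integrable (fun ω => ℓ (Z ω) θ) ν → ∫ ω, ℓ (Z ω) θ₀ ∂ν ≤ ∫ ω, ℓ (Z ω) θ ∂ν

/-- Remainder `ξ(z, t)` of the expansion
`ℓ(z, θ₀ + t) = ℓ(z, θ₀) + ℓ'(z)ᵀ t + ξ(z, t)`. -/
def lossRemainder {S : Type*} {q : ℕ} (ℓ : S → EuclideanSpace ℝ (Fin q) → ℝ)
    (θ₀ : EuclideanSpace ℝ (Fin q)) (ℓ' : S → EuclideanSpace ℝ (Fin q))
    (z : S) (t : EuclideanSpace ℝ (Fin q)) : ℝ :=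
  ℓ z (θ₀ + t) - ℓ z θ₀ - inner ℝ (ℓ' z) t

/-- The matrix `B = E(ℓ'(Z) ℓ'(Z)ᵀ / φ(Z))`. -/
def weightedScoreMatrix {S Ω' : Type*} {q : ℕ} [MeasurableSpace Ω'] (ν : Measure Ω')
    (Z : Ω' → S) (φ : S → ℝ) (ℓ' : S → EuclideanSpace ℝ (Fin q)) : Matrix (Fin q) (Fin q) ℝ :=
  Matrix.of fun j k => ∫ ω, ℓ' (Z ω) j * ℓ' (Z ω) k / φ (Z ω) ∂ν

/-- Convexity and local quadratic expansion of the loss at `θ₀`, with score `ℓ'` and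
positive-definite curvature matrix `V`. -/
structure ConvexLossExpansion {S Ω' : Type*} {q : ℕ} [MeasurableSpace S] [MeasurableSpace Ω']
    (ν : Measure Ω') (Z : Ω' → S) (φ : S → ℝ) (ℓ : S → EuclideanSpace ℝ (Fin q) → ℝ)
    (θ₀ : EuclideanSpace ℝ (Fin q)) (ℓ' : S → EuclideanSpace ℝ (Fin q))
    (V : Matrix (Fin q) (Fin q) ℝ) : Prop where
  measurable_loss : ∀ θ, Measurable fun z => ℓ z θ
  convex : ∀ z, ConvexOn ℝ Set.univ (ℓ z)
  /-- `ℓ'(z) = ∂ℓ(z, θ₀)/∂θ`, up to a null set of data (as for quantile losses). -/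
  score : ∀ᵐ ω ∂ν, HasGradientAt (ℓ (Z ω)) (ℓ' (Z ω)) θ₀
  integrable_score : Integrable (fun ω => ℓ' (Z ω)) ν
  integral_score : ∫ ω, ℓ' (Z ω) ∂ν = 0
  /-- `B` is finite. -/
  finite_B : ∀ j k, Integrable (fun ω => ℓ' (Z ω) j * ℓ' (Z ω) k / φ (Z ω)) ν
  posDef : V.PosDef
  /-- For small `t` the remainder has finite first and second moments. -/
  memLp_remainder : ∀ᶠ t in 𝓝 0, MemLp (fun ω => lossRemainder ℓ θ₀ ℓ' (Z ω) t) 2 ν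
  /-- `E ξ(Z, t) = (1/2) tᵀ V t + o(‖t‖²)` as `t → 0`. -/
  mean_remainder : (fun t : EuclideanSpace ℝ (Fin q) =>
      (∫ ω, lossRemainder ℓ θ₀ ℓ' (Z ω) t ∂ν) - (1 / 2 : ℝ) * (t.ofLp ⬝ᵥ V *ᵥ t.ofLp))
    =o[𝓝 0] fun t => ‖t‖ ^ 2
  /-- `E ξ(Z, t)² = o(‖t‖²)` as `t → 0`. -/
  sq_remainder : (fun t : EuclideanSpace ℝ (Fin q) =>
      ∫ ω, lossRemainder ℓ θ₀ ℓ' (Z ω) t ^ 2 ∂ν) =o[𝓝 0] fun t => ‖t‖ ^ 2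

/-- The inverse-probability-weighted risk
`(1/N) ∑_{i < N} (D i / φ (z i)) ℓ(z i, θ)` of a sample of size `N`. -/
def ipwRisk {S : Type*} {q : ℕ} (φ : S → ℝ) (ℓ : S → EuclideanSpace ℝ (Fin q) → ℝ) (N : ℕ)
    (z : ℕ → S) (d₁ d₂ : ℕ → ℝ) (θ : EuclideanSpace ℝ (Fin q)) : ℝ :=
  (1 / (N : ℝ)) * ∑ i ∈ Finset.range N, captured (d₁ i) (d₂ i) / φ (z i) * ℓ (z i) θ

/-- `θhat N` is an IPW estimator for every sample size `N`: it is measurable and, almost surely,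
it is a minimizer of the IPW risk whenever that risk has a minimizer. -/
structure IsIPWEstimator {S Ω : Type*} {q : ℕ} [MeasurableSpace Ω] (μ : Measure Ω)
    (Zs : ℕ → Ω → S) (D₁s D₂s : ℕ → Ω → ℝ) (φ : S → ℝ)
    (ℓ : S → EuclideanSpace ℝ (Fin q) → ℝ)
    (θhat : ℕ → Ω → EuclideanSpace ℝ (Fin q)) : Prop where
  aemeasurable : ∀ N, AEMeasurable (θhat N) μ
  minimizes : ∀ N, ∀ᵐ ω ∂μ,
    (∃ θ, ∀ θ', ipwRisk φ ℓ N (fun i => Zs i ω) (fun i => D₁s i ω) (fun i => D₂s i ω) θ ≤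
      ipwRisk φ ℓ N (fun i => Zs i ω) (fun i => D₁s i ω) (fun i => D₂s i ω) θ') →
    ∀ θ', ipwRisk φ ℓ N (fun i => Zs i ω) (fun i => D₁s i ω) (fun i => D₂s i ω) (θhat N ω) ≤
      ipwRisk φ ℓ N (fun i => Zs i ω) (fun i => D₁s i ω) (fun i => D₂s i ω) θ'

end

/-!
The estimator minimizes the convex function `θ ↦ ∑ wᵢ ℓ(Zᵢ, θ)` with the weights
`wᵢ = Dᵢ / φ(Zᵢ)`. In the local parameter `s = √N (θ - θ₀)`, and up to a constant, this function is
`⟪U_N, s⟫ + G_N(s)`, where `U_N = N^(-1/2) ∑ wᵢ ℓ'(Zᵢ)` and `G_N(s) = ∑ wᵢ ξ(Zᵢ, s / √N)`.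

* Given `Z`, the weight has mean `1` and second moment `1 / φ(Z)`
  (`CaptureRecapture.integral_ipwWeight_mul`, `CaptureRecapture.integral_ipwWeight_sq_mul`), and it
  is bounded by `1 / α₁₀`. Hence the weighted score is centred with covariance matrix `B`, and the
  moment conditions on `ξ` carry over to `w ξ`.
* By these moment conditions and Chebyshev's inequality, `G_N(s) → sᵀ V s / 2` in probability for
  each fixed `s` (`tendstoInMeasure_sum_lossRemainder`).
* `G_N` is convex, so the convergence is uniform on compact sets: uniform closeness to a continuous
  limit follows from closeness at finitely many points
  (`exists_finset_forall_convexOn_abs_sub_le`). Hence the objective is uniformly close to a parabola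
  with vertex `-V⁻¹ U_N`, and convexity forces a minimizer to exist and all minimizers to lie near
  that vertex, with probability tending to one (`tendstoInMeasure_minimizer_sub`). This is the
  argument of Hjort and Pollard; neither consistency of the estimator nor smoothness of the loss
  away from `θ₀` is needed.
* By the central limit theorem `-V⁻¹ U_N` converges in distribution to `N(0, V⁻¹ B V⁻¹)`, and the
  asymptotically equivalent `√N (θhat - θ₀)` has the same limit.
-/

/-! ### Convex functions that are close to a continuous function -/

/-- Finite-dimensional convexity lemma, in a quantitative form: to control a convex function
uniformly on a compact set, it is enough to control it at finitely many points, which depend on the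
limit, the compact set and the precision only. -/
theorem exists_finset_forall_convexOn_abs_sub_le {E : Type*} [NormedAddCommGroup E]
    [NormedSpace ℝ E] [FiniteDimensional ℝ E] {G : E → ℝ} (hG : Continuous G) {K : Set E}
    (hK : IsCompact K) {δ : ℝ} (hδ : 0 < δ) :
    ∃ F : Finset E, ∃ η > 0, ∀ f : E → ℝ, ConvexOn ℝ Set.univ f →
      (∀ v ∈ F, |f v - G v| ≤ η) → ∀ x ∈ K, |f x - G x| ≤ δ := by
  classical
  suffices h : ∃ F : Finset E, ∀ f : E → ℝ, ConvexOn ℝ Set.univ f →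
      (∀ v ∈ F, |f v - G v| ≤ δ / 5) → ∀ x ∈ K, |f x - G x| ≤ δ by
    obtain ⟨F, hF⟩ := h
    exact ⟨F, δ / 5, by positivity, hF⟩
  refine hK.induction_on ?_ ?_ ?_ ?_
  · exact ⟨∅, by simp⟩
  · rintro s t hst ⟨F, hF⟩
    exact ⟨F, fun f hf hv x hx => hF f hf hv x (hst hx)⟩
  · rintro s t ⟨F₁, h₁⟩ ⟨F₂, h₂⟩
    refine ⟨F₁ ∪ F₂, fun f hf hv x hx => ?_⟩
    rcases hx with hx | hx
    · exact h₁ f hf (fun v hv' => hv v (Finset.mem_union_left _ hv')) x hx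
    · exact h₂ f hf (fun v hv' => hv v (Finset.mem_union_right _ hv')) x hx
  intro x₀ _
  -- A small simplex around `x₀`: its vertices bound `f` from above, and the midpoint inequality
  -- at `x₀` turns the upper bound at the reflected point `2 • x₀ - x` into a lower bound at `x`.
  have hU : {y | |G y - G x₀| < δ / 5} ∈ 𝓝 x₀ := by
    have := (hG.tendsto x₀).eventually (Metric.ball_mem_nhds (G x₀) (ε := δ / 5) (by positivity))
    exact this.mono fun y hy => by simpa [Real.dist_eq] using hy
  obtain ⟨b, hb, hbU⟩ := exists_mem_interior_convexHull_affineBasis hU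
  have hrefl : Tendsto (fun x : E => (2 : ℝ) • x₀ - x) (𝓝 x₀) (𝓝 x₀) := by
    have : Continuous fun x : E => (2 : ℝ) • x₀ - x := by fun_prop
    simpa [two_smul] using this.tendsto x₀
  have hW := isOpen_interior.mem_nhds hb
  refine ⟨_, mem_nhdsWithin_of_mem_nhds (inter_mem hW (hrefl hW)),
    insert x₀ (Finset.univ.image b), fun f hf hv x hx => ?_⟩
  have hupper : ∀ y ∈ convexHull ℝ (Set.range b), f y ≤ G x₀ + 2 * (δ / 5) := by
    intro y hy
    obtain ⟨v, ⟨i, rfl⟩, hvy⟩ := hf.exists_ge_of_mem_convexHull (Set.subset_univ _) hy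
    have h₁ := hv (b i) (by simp)
    have h₂ : |G (b i) - G x₀| < δ / 5 := hbU (subset_convexHull _ _ ⟨i, rfl⟩)
    rw [abs_le] at h₁
    rw [abs_lt] at h₂
    linarith
  have h₁ := hupper _ (interior_subset hx.1)
  have h₂ := hupper _ (interior_subset hx.2)
  have h₃ : f x₀ ≤ 1 / 2 * f x + 1 / 2 * f ((2 : ℝ) • x₀ - x) := by
    have h := hf.2 (Set.mem_univ x) (Set.mem_univ ((2 : ℝ) • x₀ - x))
      (by norm_num : (0 : ℝ) ≤ 1 / 2) (by norm_num : (0 : ℝ) ≤ 1 / 2) (by norm_num)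
    have hmid : (1 / 2 : ℝ) • x + (1 / 2 : ℝ) • ((2 : ℝ) • x₀ - x) = x₀ := by module
    simpa only [hmid, smul_eq_mul] using h
  have h₄ := hv x₀ (by simp)
  have h₅ : |G x - G x₀| < δ / 5 := hbU (interior_subset hx.1)
  rw [abs_le] at h₄ ⊢
  rw [abs_lt] at h₅
  constructor <;> linarith

/-- A convex function that is larger on a sphere than at its centre has a minimizer, and all its
minimizers are inside the sphere. -/
theorem ConvexOn.exists_minimizer_and_dist_lt {E : Type*} [NormedAddCommGroup E]
    [NormedSpace ℝ E] [FiniteDimensional ℝ E] {A : E → ℝ} (hA : ConvexOn ℝ Set.univ A) {m : E}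
    {ε : ℝ} (hε : 0 < ε) (hsphere : ∀ s, dist s m = ε → A m < A s) :
    (∃ s, ∀ t, A s ≤ A t) ∧ ∀ s, (∀ t, A s ≤ A t) → dist s m < ε := by
  have hout : ∀ s, ε ≤ dist s m → A m < A s := by
    intro s hs
    have hpos : 0 < dist s m := hε.trans_le hs
    set c : ℝ := ε / dist s m with hc
    have hc0 : 0 < c := by positivity
    have hc1 : c ≤ 1 := (div_le_one hpos).2 hs
    have h := hA.2 (Set.mem_univ s) (Set.mem_univ m) hc0.le (sub_nonneg.2 hc1) (by ring)
    have h' := hsphere (c • s + (1 - c) • m) (by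
      rw [dist_eq_norm, show c • s + (1 - c) • m - m = c • (s - m) by module, norm_smul,
        Real.norm_of_nonneg hc0.le, ← dist_eq_norm, hc, div_mul_cancel₀ _ hpos.ne'])
    simp only [smul_eq_mul] at h
    by_contra hle
    have : c * A s ≤ c * A m := mul_le_mul_of_nonneg_left (not_lt.1 hle) hc0.le
    linarith
  refine ⟨?_, fun s hs => ?_⟩
  · have hcont : ContinuousOn A (Metric.closedBall m ε) :=
      (hA.continuousOn isOpen_univ).mono (Set.subset_univ _)
    obtain ⟨s, -, hs⟩ := (isCompact_closedBall m ε).exists_isMinOn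
      ⟨m, Metric.mem_closedBall_self hε.le⟩ hcont
    refine ⟨s, fun t => ?_⟩
    by_cases ht : dist t m ≤ ε
    · exact hs ht
    · exact (hs (Metric.mem_closedBall_self hε.le)).trans (hout t (not_le.1 ht).le).le
  · by_contra hlt
    exact absurd (hs m) (not_le.2 (hout s (not_lt.1 hlt)))

/-! ### Central limit theorem for random vectors -/

/-- Multivariate central limit theorem for centred square-integrable vectors; the covariance matrix
`S` enters through its quadratic form. -/
theorem tendstoInDistribution_inv_sqrt_smul_sum_multivariateGaussian {Ω ι : Type*}
    [MeasurableSpace Ω] [Fintype ι] [DecidableEq ι] {P : Measure Ω} [IsProbabilityMeasure P]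
    {Y : ℕ → Ω → EuclideanSpace ℝ ι} {S : Matrix ι ι ℝ} (hS : S.PosSemidef)
    (hindep : iIndepFun Y P) (hident : ∀ i, IdentDistrib (Y i) (Y 0) P P)
    (hL2 : MemLp (Y 0) 2 P) (hmean : ∫ ω, Y 0 ω ∂P = 0)
    (hcov : ∀ t : EuclideanSpace ℝ ι, ∫ ω, inner ℝ (Y 0 ω) t ^ 2 ∂P = t.ofLp ⬝ᵥ S *ᵥ t.ofLp) :
    TendstoInDistribution (fun (N : ℕ) ω => (Real.sqrt N)⁻¹ • ∑ i ∈ Finset.range N, Y i ω) atTop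
      (id : EuclideanSpace ℝ ι → EuclideanSpace ℝ ι) (fun _ => P) (multivariateGaussian 0 S) := by
  have hae : ∀ N : ℕ, AEMeasurable (fun ω => (Real.sqrt N)⁻¹ • ∑ i ∈ Finset.range N, Y i ω) P :=
    fun N => by
      have hY := fun i => (hident i).aemeasurable_fst
      fun_prop
  refine ⟨hae, aemeasurable_id, ?_⟩
  refine ProbabilityMeasure.tendsto_iff_tendsto_charFun.2 fun t => ?_
  have hmeas : Measurable fun y : EuclideanSpace ℝ ι => inner ℝ y t := by fun_prop
  have hX2 : MemLp (fun ω => inner ℝ (Y 0 ω) t) 2 P := by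
    refine MemLp.of_le_mul hL2 (c := ‖t‖)
      (hmeas.comp_aemeasurable (hident 0).aemeasurable_fst).aestronglyMeasurable
      (ae_of_all _ fun ω => ?_)
    rw [mul_comm]
    exact norm_inner_le_norm _ _
  have hX0 : ∫ ω, inner ℝ (Y 0 ω) t ∂P = 0 := by
    simp_rw [real_inner_comm t]
    rw [integral_inner (hL2.integrable (by norm_num)), hmean, inner_zero_right]
  have hvar : Var[fun ω => inner ℝ (Y 0 ω) t; P] = t.ofLp ⬝ᵥ S *ᵥ t.ofLp := by
    rw [variance_of_integral_eq_zero hX2.aemeasurable hX0, ← hcov t]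
  have hclt := tendstoInDistribution_inv_sqrt_mul_sum_sub
    (X := fun i ω => inner ℝ (Y i ω) t) (P := P)
    (Y := id) (P' := gaussianReal 0 Var[fun ω => inner ℝ (Y 0 ω) t; P].toNNReal)
    HasLaw.id hX2 (hindep.comp (fun _ y => inner ℝ y t) fun _ => hmeas)
    (fun i => (hident i).comp hmeas)
  simp only [hX0, mul_zero, sub_zero] at hclt
  have hlim := ProbabilityMeasure.tendsto_iff_tendsto_charFun.1 hclt.tendsto 1
  simp only [ProbabilityMeasure.coe_mk, Measure.map_id, charFun_gaussianReal, hvar,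
    charFun_multivariateGaussian hS] at hlim ⊢
  convert! hlim using 2 with N
  · rw [charFun_apply, charFun_apply, integral_map (hae N) (by fun_prop),
      integral_map (hclt.forall_aemeasurable N) (by fun_prop)]
    refine integral_congr_ae (ae_of_all _ fun ω => ?_)
    simp [real_inner_smul_left, sum_inner]
  · have : (0 : ℝ) ≤ t.ofLp ⬝ᵥ S *ᵥ t.ofLp := by
      simpa using hS.dotProduct_mulVec_nonneg t.ofLp
    simp [this]

/-! ### Weak law for triangular arrays of i.i.d. rows -/

/-- Chebyshev's inequality for row sums: if the mean of the `N`-th row sum converges to `c` and the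
sum of the second moments of its terms tends to `0`, then the row sums converge to `c` in
probability. -/
theorem tendstoInMeasure_sum_of_tendsto_moments {Ω T : Type*} [MeasurableSpace Ω]
    [MeasurableSpace T] {P : Measure Ω} [IsProbabilityMeasure P] {ρ : Measure T}
    {X : ℕ → Ω → T} (hindep : iIndepFun X P) (hX : ∀ i, HasLaw (X i) ρ P)
    {ψ : ℕ → T → ℝ} (hψ : ∀ N, Measurable (ψ N)) (hψ2 : ∀ᶠ N in atTop, MemLp (ψ N) 2 ρ) {c : ℝ}
    (hmean : Tendsto (fun N : ℕ => N * ∫ x, ψ N x ∂ρ) atTop (𝓝 c))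
    (hsq : Tendsto (fun N : ℕ => N * ∫ x, ψ N x ^ 2 ∂ρ) atTop (𝓝 0)) :
    TendstoInMeasure P (fun (N : ℕ) ω => ∑ i ∈ Finset.range N, ψ N (X i ω)) atTop fun _ => c := by
  rw [tendstoInMeasure_iff_norm]
  intro ε hε
  have hbound : Tendsto
      (fun N : ℕ => ENNReal.ofReal ((N * ∫ x, ψ N x ^ 2 ∂ρ) / (ε / 2) ^ 2)) atTop (𝓝 0) := by
    simpa using ENNReal.tendsto_ofReal (hsq.div_const ((ε / 2) ^ 2))
  refine tendsto_of_tendsto_of_tendsto_of_le_of_le' tendsto_const_nhds hbound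
    (Eventually.of_forall fun _ => zero_le) ?_
  have hclose := hmean.eventually (Metric.ball_mem_nhds c (half_pos hε))
  filter_upwards [hψ2, hclose] with N hN hNc
  have hL2 : ∀ i, MemLp (fun ω => ψ N (X i ω)) 2 P := fun i => by
    have h := (hX i).map_eq ▸ hN
    exact h.comp_of_map (hX i).aemeasurable
  have hsum2 : MemLp (fun ω => ∑ i ∈ Finset.range N, ψ N (X i ω)) 2 P :=
    memLp_finsetSum _ fun i _ => hL2 i
  have hint : ∀ i, ∫ ω, ψ N (X i ω) ∂P = ∫ x, ψ N x ∂ρ := fun i =>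
    (hX i).integral_comp (hψ N).aestronglyMeasurable
  have hE : ∫ ω, ∑ i ∈ Finset.range N, ψ N (X i ω) ∂P = N * ∫ x, ψ N x ∂ρ := by
    rw [integral_finsetSum _ fun i _ => (hL2 i).integrable (by norm_num)]
    simp [hint]
  have hVar : Var[fun ω => ∑ i ∈ Finset.range N, ψ N (X i ω); P] ≤ N * ∫ x, ψ N x ^ 2 ∂ρ := by
    have h := IndepFun.variance_sum (μ := P) (X := fun i ω => ψ N (X i ω)) (s := Finset.range N)
      (fun i _ => hL2 i)
      (fun i _ j _ hij => (hindep.indepFun hij).comp (hψ N) (hψ N))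
    rw [Finset.sum_fn] at h
    have hle : ∀ i ∈ Finset.range N, Var[fun ω => ψ N (X i ω); P] ≤ ∫ x, ψ N x ^ 2 ∂ρ := ?_
    · simpa [h] using Finset.sum_le_sum hle
    intro i _
    refine (variance_le_expectation_sq (hL2 i).aestronglyMeasurable).trans_eq ?_
    exact (hX i).integral_comp (f := fun x => ψ N x ^ 2) ((hψ N).pow_const 2).aestronglyMeasurable
  have hcheb := meas_ge_le_variance_div_sq hsum2 (half_pos hε)
  refine (measure_mono fun ω hω => ?_).trans (hcheb.trans (ENNReal.ofReal_le_ofReal ?_))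
  · simp only [Set.mem_ofPred_eq, hE, Real.norm_eq_abs] at hω ⊢
    rw [Real.dist_eq] at hNc
    have := abs_sub_le (∑ i ∈ Finset.range N, ψ N (X i ω)) (N * ∫ x, ψ N x ∂ρ) c
    linarith
  · gcongr

theorem tendsto_inv_sqrt_smul_nhds_zero {E : Type*} [NormedAddCommGroup E] [NormedSpace ℝ E]
    (s : E) : Tendsto (fun N : ℕ => (Real.sqrt N)⁻¹ • s) atTop (𝓝 0) := by
  have h : Tendsto (fun N : ℕ => (Real.sqrt N)⁻¹) atTop (𝓝 0) :=
    tendsto_inv_atTop_zero.comp (Real.tendsto_sqrt_atTop.comp tendsto_natCast_atTop_atTop)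
  simpa using h.smul_const s

/-- An `o(‖t‖²)` bound, rescaled along `t = s / √N`. -/
theorem Asymptotics.IsLittleO.tendsto_natCast_mul_inv_sqrt_smul {E : Type*} [NormedAddCommGroup E]
    [NormedSpace ℝ E] {h : E → ℝ} (hh : h =o[𝓝 0] fun t => ‖t‖ ^ 2) (s : E) :
    Tendsto (fun N : ℕ => N * h ((Real.sqrt N)⁻¹ • s)) atTop (𝓝 0) := by
  have h₁ : (fun N : ℕ => N * h ((Real.sqrt N)⁻¹ • s)) =o[atTop]
      fun N : ℕ => (N : ℝ) * ‖(Real.sqrt N)⁻¹ • s‖ ^ 2 :=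
    (isBigO_refl _ _).mul_isLittleO (hh.comp_tendsto (tendsto_inv_sqrt_smul_nhds_zero s))
  have h₂ : (fun N : ℕ => (N : ℝ) * ‖(Real.sqrt N)⁻¹ • s‖ ^ 2) =O[atTop] fun _ => (1 : ℝ) := by
    refine IsBigO.of_bound (‖s‖ ^ 2) (Eventually.of_forall fun N => ?_)
    rw [norm_smul, mul_pow, norm_inv, Real.norm_of_nonneg (Real.sqrt_nonneg _), inv_pow,
      Real.sq_sqrt N.cast_nonneg, ← mul_assoc]
    rcases eq_or_ne (N : ℝ) 0 with h0 | h0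
    · rw [h0]
      simp
    · rw [mul_inv_cancel₀ h0]
      simp
  exact (isLittleO_one_iff ℝ).1 (h₁.trans_isBigO h₂)

/-- At each fixed local parameter `s`, the sum of the remainders at `s / √N` converges in
probability to the quadratic form of the curvature matrix. -/
theorem tendstoInMeasure_sum_lossRemainder {Ω T : Type*} {q : ℕ} [MeasurableSpace Ω]
    [MeasurableSpace T] {P : Measure Ω} [IsProbabilityMeasure P] {ρ : Measure T}
    {X : ℕ → Ω → T} (hindep : iIndepFun X P) (hX : ∀ i, HasLaw (X i) ρ P)
    {f : T → EuclideanSpace ℝ (Fin q) → ℝ} {θ₀ : EuclideanSpace ℝ (Fin q)}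
    {g : T → EuclideanSpace ℝ (Fin q)} {V : Matrix (Fin q) (Fin q) ℝ}
    (hf : ∀ θ, Measurable fun x => f x θ) (hg : Measurable g)
    (hr2 : ∀ᶠ t in 𝓝 0, MemLp (fun x => lossRemainder f θ₀ g x t) 2 ρ)
    (hr : (fun t : EuclideanSpace ℝ (Fin q) =>
      (∫ x, lossRemainder f θ₀ g x t ∂ρ) - (1 / 2 : ℝ) * (t.ofLp ⬝ᵥ V *ᵥ t.ofLp))
        =o[𝓝 0] fun t => ‖t‖ ^ 2)
    (hrsq : (fun t : EuclideanSpace ℝ (Fin q) => ∫ x, lossRemainder f θ₀ g x t ^ 2 ∂ρ)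
      =o[𝓝 0] fun t => ‖t‖ ^ 2) (s : EuclideanSpace ℝ (Fin q)) :
    TendstoInMeasure P
      (fun (N : ℕ) ω => ∑ i ∈ Finset.range N,
        lossRemainder f θ₀ g (X i ω) ((Real.sqrt N)⁻¹ • s))
      atTop fun _ => 1 / 2 * (s.ofLp ⬝ᵥ V *ᵥ s.ofLp) := by
  refine tendstoInMeasure_sum_of_tendsto_moments hindep hX
    (ψ := fun N x => lossRemainder f θ₀ g x ((Real.sqrt N)⁻¹ • s)) (fun N => ?_)
    ((tendsto_inv_sqrt_smul_nhds_zero s).eventually hr2) ?_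
    (hrsq.tendsto_natCast_mul_inv_sqrt_smul s)
  · unfold lossRemainder
    have h₁ := hf (θ₀ + (Real.sqrt N)⁻¹ • s)
    have h₂ := hf θ₀
    fun_prop
  · have h := (hr.tendsto_natCast_mul_inv_sqrt_smul s).add_const
      (1 / 2 * (s.ofLp ⬝ᵥ V *ᵥ s.ofLp))
    rw [zero_add] at h
    refine h.congr' ?_
    filter_upwards [eventually_ge_atTop 1] with N hN
    have hN0 : (N : ℝ) ≠ 0 := by positivity
    have hsq : (N : ℝ) * ((Real.sqrt N)⁻¹ * (Real.sqrt N)⁻¹) = 1 := by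
      rw [← mul_inv, Real.mul_self_sqrt N.cast_nonneg, mul_inv_cancel₀ hN0]
    simp only [WithLp.ofLp_smul, Matrix.mulVec_smul, smul_dotProduct, dotProduct_smul, smul_eq_mul]
    linear_combination (-(1 / 2) * (s.ofLp ⬝ᵥ V *ᵥ s.ofLp)) * hsq

/-! ### Minimizers of convex random functions -/

theorem dotProduct_mulVec_add_self {ι : Type*} [Fintype ι] {V : Matrix ι ι ℝ}
    (hV : V.IsSymm) (a b : ι → ℝ) :
    (a + b) ⬝ᵥ V *ᵥ (a + b) = a ⬝ᵥ V *ᵥ a + 2 * (b ⬝ᵥ V *ᵥ a) + b ⬝ᵥ V *ᵥ b := by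
  have h : a ⬝ᵥ V *ᵥ b = b ⬝ᵥ V *ᵥ a := by
    rw [Matrix.dotProduct_mulVec, ← Matrix.mulVec_transpose, hV.eq, dotProduct_comm]
  rw [Matrix.mulVec_add, add_dotProduct, dotProduct_add, dotProduct_add, h]
  ring

/-- A function that is uniformly close to the quadratic `s ↦ ⟪u, s⟫ + sᵀ V s / 2` near the vertex
`m` of the latter (`V m = -u`) is larger on a small sphere around `m` than at `m`. -/
theorem lt_of_abs_sub_quadratic_le {q : ℕ} {V : Matrix (Fin q) (Fin q) ℝ} (hV : V.IsSymm)
    {G : EuclideanSpace ℝ (Fin q) → ℝ} {u m s : EuclideanSpace ℝ (Fin q)} {δ κ : ℝ}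
    (hm : V *ᵥ m.ofLp = -u.ofLp)
    (hGm : |G m - 1 / 2 * (m.ofLp ⬝ᵥ V *ᵥ m.ofLp)| ≤ δ)
    (hGs : |G s - 1 / 2 * (s.ofLp ⬝ᵥ V *ᵥ s.ofLp)| ≤ δ)
    (hκ : κ ≤ (s - m).ofLp ⬝ᵥ V *ᵥ (s - m).ofLp) (hδ : 4 * δ < κ) :
    inner ℝ u m + G m < inner ℝ u s + G s := by
  have hquad := dotProduct_mulVec_add_self hV m.ofLp (s - m).ofLp
  have hcross : (s - m).ofLp ⬝ᵥ V *ᵥ m.ofLp = -inner ℝ u (s - m) := by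
    rw [hm, dotProduct_neg, EuclideanSpace.inner_eq_star_dotProduct]
    simp
  rw [hcross, inner_sub_right, ← WithLp.ofLp_add, add_sub_cancel] at hquad
  rw [abs_le] at hGm hGs
  linarith [hGm.1, hGm.2, hGs.1, hGs.2]

/-- Tightness of a sequence that converges in distribution. -/
theorem MeasureTheory.TendstoInDistribution.exists_forall_measure_norm_gt_le {Ω Ω' E : Type*}
    [MeasurableSpace Ω] [MeasurableSpace Ω'] {P : Measure Ω} [IsProbabilityMeasure P]
    {P' : Measure Ω'} [IsProbabilityMeasure P'] [NormedAddCommGroup E] [InnerProductSpace ℝ E]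
    [FiniteDimensional ℝ E] [MeasurableSpace E] [BorelSpace E] {X : ℕ → Ω → E} {Z : Ω' → E}
    (h : TendstoInDistribution X atTop Z (fun _ => P) P') {κ : ENNReal} (hκ : 0 < κ) :
    ∃ M : ℝ, ∀ N, P {ω | M < ‖X N ω‖} ≤ κ := by
  have : ∀ N, IsProbabilityMeasure (P.map (X N)) := fun N =>
    Measure.isProbabilityMeasure_map (h.forall_aemeasurable N)
  have : IsProbabilityMeasure (P'.map Z) := Measure.isProbabilityMeasure_map h.aemeasurable_limit
  have htight : IsTightMeasureSet (Set.range fun N => P.map (X N)) :=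
    isTightMeasureSet_of_tendsto_charFun (f := charFun (P'.map Z)) (by fun_prop)
      (ProbabilityMeasure.tendsto_iff_tendsto_charFun.1 h.tendsto)
  obtain ⟨M, hM⟩ := ((isTightMeasureSet_iff_tendsto_measure_norm_gt.1 htight).eventually
    (ge_mem_nhds hκ)).exists
  refine ⟨M, fun N => ?_⟩
  have hN : (P.map (X N)) {x | M < ‖x‖} ≤ κ :=
    (le_iSup₂ (f := fun (ρ : Measure E) (_ : ρ ∈ Set.range fun N => P.map (X N)) =>
      ρ {x | M < ‖x‖}) _ ⟨N, rfl⟩).trans hM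
  rwa [Measure.map_apply_of_aemeasurable (h.forall_aemeasurable N)
    (measurableSet_lt measurable_const measurable_norm)] at hN

/-- The argmin principle for convex functions. Let `A N` be convex random functions such that
`A N s - ⟪u N, s⟫` converges in probability, at every fixed `s`, to the positive definite quadratic
form `sᵀ V s / 2`. If the vertices `m N = -V⁻¹ u N` of the limiting parabolas are tight, then
minimizers of `A N` exist with probability tending to one and are asymptotically equivalent
to `m N`. -/
theorem tendstoInMeasure_minimizer_sub {Ω : Type*} {q : ℕ} [MeasurableSpace Ω] {P : Measure Ω}
    {V : Matrix (Fin q) (Fin q) ℝ} (hV : V.PosDef)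
    {A : ℕ → Ω → EuclideanSpace ℝ (Fin q) → ℝ} {u m shat : ℕ → Ω → EuclideanSpace ℝ (Fin q)}
    (hA : ∀ N ω, ConvexOn ℝ Set.univ (A N ω))
    (hm : ∀ N ω, V *ᵥ (m N ω).ofLp = -(u N ω).ofLp)
    (htight : ∀ κ : ENNReal, 0 < κ → ∃ M : ℝ, ∀ N, P {ω | M < ‖m N ω‖} ≤ κ)
    (hlim : ∀ s, TendstoInMeasure P (fun N ω => A N ω s - inner ℝ (u N ω) s) atTop
      fun _ => 1 / 2 * (s.ofLp ⬝ᵥ V *ᵥ s.ofLp))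
    (hmin : ∀ᶠ N in atTop, ∀ᵐ ω ∂P, (∃ s, ∀ t, A N ω s ≤ A N ω t) →
      ∀ t, A N ω (shat N ω) ≤ A N ω t) :
    TendstoInMeasure P (shat - m) atTop 0 := by
  rw [tendstoInMeasure_iff_norm]
  intro ε₀ hε₀
  set ε : ℝ := min ε₀ 1
  have hε : 0 < ε := lt_min hε₀ one_pos
  rw [ENNReal.tendsto_nhds_zero]
  intro κ hκ
  obtain ⟨M, hM⟩ := htight (κ / 2) (ENNReal.half_pos hκ.ne')
  have hVsymm : V.IsSymm := by simpa [Matrix.IsHermitian, Matrix.IsSymm] using hV.1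
  have hJ : Continuous fun s : EuclideanSpace ℝ (Fin q) => s.ofLp ⬝ᵥ V *ᵥ s.ofLp := by
    fun_prop
  obtain ⟨c, hc, hcs⟩ := (isCompact_sphere (0 : EuclideanSpace ℝ (Fin q)) ε).exists_forall_le'
    (f := fun s => s.ofLp ⬝ᵥ V *ᵥ s.ofLp) (a := 0) hJ.continuousOn (fun s hs => by
      have hs0 : s.ofLp ≠ 0 := by
        rintro h0
        have : s = 0 := by ext i; simp [h0]
        rw [mem_sphere_zero_iff_norm, this, norm_zero] at hs
        exact hε.ne hs
      simpa using hV.dotProduct_mulVec_pos hs0)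
  obtain ⟨F, η, hη, hF⟩ := exists_finset_forall_convexOn_abs_sub_le
    (G := fun s : EuclideanSpace ℝ (Fin q) => 1 / 2 * (s.ofLp ⬝ᵥ V *ᵥ s.ofLp))
    (continuous_const.mul hJ) (isCompact_closedBall 0 (M + 1)) (δ := c / 5) (by positivity)
  have hsum : Tendsto (fun N => ∑ v ∈ F, P {ω | η ≤ ‖A N ω v - inner ℝ (u N ω) v
      - 1 / 2 * (v.ofLp ⬝ᵥ V *ᵥ v.ofLp)‖}) atTop (𝓝 0) := by
    simpa using tendsto_finsetSum F fun v _ => tendstoInMeasure_iff_norm.1 (hlim v) η hη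
  filter_upwards [hmin, ENNReal.tendsto_nhds_zero.1 hsum (κ / 2) (ENNReal.half_pos hκ.ne')]
    with N hN hsumN
  have hcover : ∀ᵐ ω ∂P, ω ∈ {ω | ε₀ ≤ ‖(shat - m) N ω - (0 : Ω → EuclideanSpace ℝ (Fin q)) ω‖} →
      ω ∈ {ω | M < ‖m N ω‖} ∪ ⋃ v ∈ F, {ω | η ≤ ‖A N ω v - inner ℝ (u N ω) v
        - 1 / 2 * (v.ofLp ⬝ᵥ V *ᵥ v.ofLp)‖} := by
    filter_upwards [hN] with ω hω hbad
    by_contra hgood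
    simp only [Set.mem_union, Set.mem_iUnion, Set.mem_ofPred_eq, not_or, not_exists, not_lt,
      not_le, Real.norm_eq_abs] at hgood
    obtain ⟨hmM, hclose⟩ := hgood
    have hG : ConvexOn ℝ Set.univ fun s => A N ω s - inner ℝ (u N ω) s :=
      (hA N ω).sub ((innerₛₗ ℝ (u N ω)).concaveOn convex_univ)
    have hunif := hF _ hG fun v hv => (hclose v hv).le
    have hsphere : ∀ s, dist s (m N ω) = ε → A N ω (m N ω) < A N ω s := by
      intro s hs
      have hsM : ‖s‖ ≤ M + 1 := by
        have h₁ : ‖s‖ ≤ dist s (m N ω) + ‖m N ω‖ := by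
          rw [dist_eq_norm]
          simpa using norm_add_le (s - m N ω) (m N ω)
        linarith [min_le_right ε₀ 1]
      have h := lt_of_abs_sub_quadratic_le (δ := c / 5)
        (G := fun s => A N ω s - inner ℝ (u N ω) s) hVsymm (hm N ω)
        (hunif (m N ω) (by simpa using by linarith)) (hunif s (by simpa using hsM))
        (hcs (s - m N ω) (by simpa [dist_eq_norm] using hs)) (by linarith)
      simpa using h
    obtain ⟨hex, hdist⟩ := (hA N ω).exists_minimizer_and_dist_lt hε hsphere
    have h := hdist _ (hω hex)
    rw [dist_eq_norm] at h
    have hbad' : ε₀ ≤ ‖shat N ω - m N ω‖ := by simpa using hbad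
    linarith [min_le_left ε₀ 1]
  calc P {ω | ε₀ ≤ ‖(shat - m) N ω - (0 : Ω → EuclideanSpace ℝ (Fin q)) ω‖}
      ≤ P ({ω | M < ‖m N ω‖} ∪ ⋃ v ∈ F, {ω | η ≤ ‖A N ω v - inner ℝ (u N ω) v
        - 1 / 2 * (v.ofLp ⬝ᵥ V *ᵥ v.ofLp)‖}) := measure_mono_ae hcover
    _ ≤ κ / 2 + κ / 2 := (measure_union_le _ _).trans
        (add_le_add (hM N) ((measure_biUnion_finset_le _ _).trans hsumN))
    _ = κ := ENNReal.add_halves κ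

/-! ### Asymptotic normality of convex M-estimators -/

theorem toEuclideanCLM_inv_apply {q : ℕ} {V : Matrix (Fin q) (Fin q) ℝ} (hV : V.PosDef)
    (u : EuclideanSpace ℝ (Fin q)) :
    V *ᵥ (Matrix.toEuclideanCLM (𝕜 := ℝ) V⁻¹ u).ofLp = u.ofLp := by
  rw [Matrix.ofLp_toEuclideanCLM, Matrix.mulVec_mulVec,
    Matrix.mul_nonsing_inv _ ((Matrix.isUnit_iff_isUnit_det V).1 hV.isUnit), Matrix.one_mulVec]

/-- The second moments of a square-integrable vector in a given direction. -/
theorem integral_inner_sq_eq_dotProduct_mulVec {T : Type*} {q : ℕ} [MeasurableSpace T]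
    {ρ : Measure T} {g : T → EuclideanSpace ℝ (Fin q)} {B : Matrix (Fin q) (Fin q) ℝ}
    (hgB : ∀ j k, Integrable (fun x => g x j * g x k) ρ)
    (hB : ∀ j k, ∫ x, g x j * g x k ∂ρ = B j k) (t : EuclideanSpace ℝ (Fin q)) :
    ∫ x, inner ℝ (g x) t ^ 2 ∂ρ = t.ofLp ⬝ᵥ B *ᵥ t.ofLp := by
  have hexp : ∀ x, inner ℝ (g x) t ^ 2 = ∑ j, ∑ k, t j * t k * (g x j * g x k) := by
    intro x
    rw [sq, PiLp.inner_apply, Finset.sum_mul_sum]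
    refine Finset.sum_congr rfl fun j _ => Finset.sum_congr rfl fun k _ => ?_
    simp
    ring
  simp_rw [hexp]
  rw [integral_finsetSum _ fun j _ => integrable_finsetSum _ fun k _ => (hgB j k).const_mul _]
  simp only [dotProduct, Matrix.mulVec, Finset.mul_sum]
  refine Finset.sum_congr rfl fun j _ => ?_
  rw [integral_finsetSum _ fun k _ => (hgB j k).const_mul _]
  refine Finset.sum_congr rfl fun k _ => ?_
  rw [integral_const_mul, hB]
  ring

theorem posSemidef_of_integral_mul_eq {T : Type*} {q : ℕ} [MeasurableSpace T]
    {ρ : Measure T} {g : T → EuclideanSpace ℝ (Fin q)} {B : Matrix (Fin q) (Fin q) ℝ}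
    (hgB : ∀ j k, Integrable (fun x => g x j * g x k) ρ)
    (hB : ∀ j k, ∫ x, g x j * g x k ∂ρ = B j k) : B.PosSemidef := by
  refine Matrix.PosSemidef.of_dotProduct_mulVec_nonneg ?_ fun t => ?_
  · ext j k
    simp only [Matrix.conjTranspose_apply, star_trivial, ← hB]
    simp_rw [mul_comm]
  · have h := integral_inner_sq_eq_dotProduct_mulVec hgB hB (WithLp.toLp 2 t)
    simp only [star_trivial]
    rw [← h]
    exact integral_nonneg fun x => sq_nonneg _

/-- Taking out the linear term of the remainder expansion at the local parameter `s / √N`. -/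
theorem sum_sub_sum_eq_inner_add_sum_lossRemainder {T : Type*} {q : ℕ}
    (f : T → EuclideanSpace ℝ (Fin q) → ℝ) (θ₀ : EuclideanSpace ℝ (Fin q))
    (g : T → EuclideanSpace ℝ (Fin q)) (x : ℕ → T) (N : ℕ) (c : ℝ)
    (s : EuclideanSpace ℝ (Fin q)) :
    ∑ i ∈ Finset.range N, (f (x i) (θ₀ + c • s) - f (x i) θ₀)
      = inner ℝ (c • ∑ i ∈ Finset.range N, g (x i)) s
        + ∑ i ∈ Finset.range N, lossRemainder f θ₀ g (x i) (c • s) := by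
  simp only [lossRemainder, Finset.sum_sub_distrib, real_inner_smul_left, real_inner_smul_right,
    sum_inner, ← Finset.mul_sum]
  ring

/-- Asymptotic normality of minimizers of convex empirical risks. That `g` is the score of the loss
`f` at `θ₀` enters only through the moments of the remainder of the linear expansion;
differentiability at individual data is not needed. -/
theorem tendstoInDistribution_sqrt_smul_minimizer_sub {Ω T : Type*} {q : ℕ} [MeasurableSpace Ω]
    [MeasurableSpace T] {P : Measure Ω} [IsProbabilityMeasure P] {ρ : Measure T}
    {X : ℕ → Ω → T} (hindep : iIndepFun X P) (hX : ∀ i, HasLaw (X i) ρ P)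
    {f : T → EuclideanSpace ℝ (Fin q) → ℝ} {θ₀ : EuclideanSpace ℝ (Fin q)}
    {g : T → EuclideanSpace ℝ (Fin q)} {V B : Matrix (Fin q) (Fin q) ℝ}
    (hf : ∀ θ, Measurable fun x => f x θ) (hconv : ∀ x, ConvexOn ℝ Set.univ (f x))
    (hg : Measurable g) (hg2 : MemLp g 2 ρ) (hg0 : ∫ x, g x ∂ρ = 0)
    (hgB : ∀ j k, Integrable (fun x => g x j * g x k) ρ)
    (hB : ∀ j k, ∫ x, g x j * g x k ∂ρ = B j k) (hV : V.PosDef)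
    (hr2 : ∀ᶠ t in 𝓝 0, MemLp (fun x => lossRemainder f θ₀ g x t) 2 ρ)
    (hr : (fun t : EuclideanSpace ℝ (Fin q) =>
      (∫ x, lossRemainder f θ₀ g x t ∂ρ) - (1 / 2 : ℝ) * (t.ofLp ⬝ᵥ V *ᵥ t.ofLp))
        =o[𝓝 0] fun t => ‖t‖ ^ 2)
    (hrsq : (fun t : EuclideanSpace ℝ (Fin q) => ∫ x, lossRemainder f θ₀ g x t ^ 2 ∂ρ)
      =o[𝓝 0] fun t => ‖t‖ ^ 2)
    {θhat : ℕ → Ω → EuclideanSpace ℝ (Fin q)} (hθ : ∀ N, AEMeasurable (θhat N) P)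
    (hmin : ∀ᶠ N in atTop, ∀ᵐ ω ∂P,
      (∃ θ, ∀ θ', ∑ i ∈ Finset.range N, f (X i ω) θ ≤ ∑ i ∈ Finset.range N, f (X i ω) θ') →
      ∀ θ', ∑ i ∈ Finset.range N, f (X i ω) (θhat N ω) ≤ ∑ i ∈ Finset.range N, f (X i ω) θ') :
    TendstoInDistribution (fun (N : ℕ) (ω : Ω) => Real.sqrt (N : ℝ) • (θhat N ω - θ₀)) atTop
      (id : EuclideanSpace ℝ (Fin q) → EuclideanSpace ℝ (Fin q)) (fun _ => P)
      (multivariateGaussian 0 (V⁻¹ * B * V⁻¹)) := by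
  set L := Matrix.toEuclideanCLM (𝕜 := ℝ) (n := Fin q) V⁻¹ with hL
  have hVinv : (V⁻¹)ᴴ = V⁻¹ := hV.1.inv
  have hBpos : B.PosSemidef := posSemidef_of_integral_mul_eq hgB hB
  have hSpos : (V⁻¹ * B * V⁻¹).PosSemidef := by
    have h := hBpos.conjTranspose_mul_mul_same V⁻¹
    rwa [hVinv] at h
  have hLg : Measurable fun x => -L (g x) := (L.continuous.measurable.comp hg).neg
  have hident : ∀ i, IdentDistrib (fun ω => -L (g (X i ω))) (fun ω => -L (g (X 0 ω))) P P :=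
    fun i =>
      have h : IdentDistrib (X i) (X 0) P P :=
        ⟨(hX i).aemeasurable, (hX 0).aemeasurable, (hX i).map_eq.trans (hX 0).map_eq.symm⟩
      h.comp hLg
  have hLg2 : MemLp (fun x => -L (g x)) 2 ρ := (L.comp_memLp' hg2).neg
  -- The vertices of the limiting parabolas are the normalized sums of `-V⁻¹ g`.
  have hclt : TendstoInDistribution
      (fun (N : ℕ) ω => (Real.sqrt N)⁻¹ • ∑ i ∈ Finset.range N, -L (g (X i ω))) atTop
      (id : EuclideanSpace ℝ (Fin q) → EuclideanSpace ℝ (Fin q)) (fun _ => P)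
      (multivariateGaussian 0 (V⁻¹ * B * V⁻¹)) := by
    refine tendstoInDistribution_inv_sqrt_smul_sum_multivariateGaussian hSpos
      (Y := fun i ω => -L (g (X i ω))) (hindep.comp (fun _ x => -L (g x)) fun _ => hLg) hident
      ?_ ?_ fun t => ?_
    · exact ((hX 0).map_eq ▸ hLg2 : MemLp _ 2 (P.map (X 0))).comp_of_map (hX 0).aemeasurable
    · refine ((hX 0).integral_comp hLg.aestronglyMeasurable).trans ?_
      have : IsProbabilityMeasure ρ := (hX 0).isProbabilityMeasure_iff.1 inferInstance
      rw [integral_neg, L.integral_comp_comm (hg2.integrable (by norm_num)), hg0, map_zero,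
        neg_zero]
    · refine ((hX 0).integral_comp (f := fun x => inner ℝ (-L (g x)) t ^ 2)
        (by fun_prop)).trans ?_
      have hadj : ∀ x, inner ℝ (-L (g x)) t ^ 2 = inner ℝ (g x) (L t) ^ 2 := by
        intro x
        rw [inner_neg_left, neg_sq, ← ContinuousLinearMap.adjoint_inner_right,
          ← ContinuousLinearMap.star_eq_adjoint, hL, ← map_star, Matrix.star_eq_conjTranspose,
          hVinv]
      simp_rw [hadj]
      rw [integral_inner_sq_eq_dotProduct_mulVec hgB hB, hL, Matrix.ofLp_toEuclideanCLM,
        ← Matrix.mulVec_mulVec, ← Matrix.mulVec_mulVec, Matrix.dotProduct_mulVec t.ofLp,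
        ← Matrix.mulVec_transpose, ← Matrix.conjTranspose_eq_transpose_of_trivial, hVinv]
  refine tendstoInDistribution_of_tendstoInMeasure_sub _ _ hclt ?_
    fun N => ((hθ N).sub_const _).const_smul (Real.sqrt N)
  refine tendstoInMeasure_minimizer_sub hV
    (A := fun N ω s => ∑ i ∈ Finset.range N,
      (f (X i ω) (θ₀ + (Real.sqrt N)⁻¹ • s) - f (X i ω) θ₀))
    (u := fun N ω => (Real.sqrt N)⁻¹ • ∑ i ∈ Finset.range N, g (X i ω)) (fun N ω => ?_)
    (fun N ω => ?_) (fun κ hκ => hclt.exists_forall_measure_norm_gt_le hκ) (fun s => ?_) ?_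
  · rw [← Finset.sum_fn]
    refine Finset.sum_induction _ (ConvexOn ℝ Set.univ) (fun _ _ => ConvexOn.add)
      (convexOn_const 0 convex_univ) fun i _ => ?_
    simp_rw [sub_eq_add_neg]
    refine ConvexOn.add_const ?_ _
    exact (hconv (X i ω)).comp_affineMap
      (AffineMap.const ℝ (EuclideanSpace ℝ (Fin q)) θ₀
        + (Real.sqrt N)⁻¹ • AffineMap.id ℝ (EuclideanSpace ℝ (Fin q)))
  · have : (Real.sqrt N)⁻¹ • ∑ i ∈ Finset.range N, -L (g (X i ω))
        = -L ((Real.sqrt N)⁻¹ • ∑ i ∈ Finset.range N, g (X i ω)) := by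
      simp [Finset.sum_neg_distrib]
    rw [this, WithLp.ofLp_neg, Matrix.mulVec_neg, hL, toEuclideanCLM_inv_apply hV]
  · simpa only [fun N ω => sum_sub_sum_eq_inner_add_sum_lossRemainder f θ₀ g (fun i => X i ω) N
      (Real.sqrt N)⁻¹ s, add_sub_cancel_left] using
      tendstoInMeasure_sum_lossRemainder hindep hX hf hg hr2 hr hrsq s
  · filter_upwards [hmin, eventually_ge_atTop 1] with N hN hN1
    have hsqrt : Real.sqrt N ≠ 0 := by positivity
    have hback : ∀ θ, θ₀ + (Real.sqrt N)⁻¹ • Real.sqrt N • (θ - θ₀) = θ := by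
      intro θ
      rw [smul_smul, inv_mul_cancel₀ hsqrt, one_smul, add_sub_cancel]
    filter_upwards [hN] with ω hω
    simp only [Finset.sum_sub_distrib, sub_le_sub_iff_right]
    rintro ⟨s, hs⟩ t
    rw [hback]
    refine hω ⟨θ₀ + (Real.sqrt N)⁻¹ • s, fun θ' => ?_⟩ _
    simpa only [hback] using hs (Real.sqrt N • (θ' - θ₀))

/-! ### Capture--recapture weights -/

/-- The inverse-probability weight `D / φ(Z)` as a function of the observation `(Z, D₁, D₂)`. -/
noncomputable def ipwWeight {S : Type*} (φ : S → ℝ) (x : S × ℝ × ℝ) : ℝ :=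
  captured x.2.1 x.2.2 / φ x.1

theorem measurable_captured : Measurable fun d : ℝ × ℝ => captured d.1 d.2 := by
  unfold captured
  exact Measurable.ite (measurableSet_lt measurable_const (by fun_prop)) measurable_const
    measurable_const

theorem captured_nonneg (d₁ d₂ : ℝ) : 0 ≤ captured d₁ d₂ := by
  unfold captured
  split_ifs <;> norm_num

theorem captured_le_one (d₁ d₂ : ℝ) : captured d₁ d₂ ≤ 1 := by
  unfold captured
  split_ifs <;> norm_num

theorem captured_mul_self (d₁ d₂ : ℝ) : captured d₁ d₂ * captured d₁ d₂ = captured d₁ d₂ := by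
  unfold captured
  split_ifs <;> norm_num

theorem captured_eq_add_sub_mul {d₁ d₂ : ℝ} (h₁ : d₁ = 0 ∨ d₁ = 1) (h₂ : d₂ = 0 ∨ d₂ = 1) :
    captured d₁ d₂ = d₁ + d₂ - d₁ * d₂ := by
  rcases h₁ with rfl | rfl <;> rcases h₂ with rfl | rfl <;> norm_num [captured]

theorem le_inclusionProb {S : Type*} {α : ℝ} {π : S → ℝ} {z : S} (hα : α ≤ 1) (hπ : 0 ≤ π z) :
    α ≤ inclusionProb α π z := by
  unfold inclusionProb
  nlinarith

theorem inclusionProb_le_one {S : Type*} {α : ℝ} {π : S → ℝ} {z : S} (hα : α ≤ 1)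
    (hπ : π z ≤ 1) : inclusionProb α π z ≤ 1 := by
  unfold inclusionProb
  nlinarith

theorem measurable_ipwWeight {S : Type*} [MeasurableSpace S] {φ : S → ℝ} (hφ : Measurable φ) :
    Measurable (ipwWeight φ) :=
  (measurable_captured.comp measurable_snd).div (hφ.comp measurable_fst)

theorem ipwWeight_nonneg {S : Type*} {φ : S → ℝ} {x : S × ℝ × ℝ} (hφ : 0 ≤ φ x.1) :
    0 ≤ ipwWeight φ x :=
  div_nonneg (captured_nonneg _ _) hφ

theorem ipwWeight_le {S : Type*} {φ : S → ℝ} {x : S × ℝ × ℝ} {α : ℝ} (hα : 0 < α)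
    (hφ : α ≤ φ x.1) : ipwWeight φ x ≤ α⁻¹ := by
  rw [ipwWeight, inv_eq_one_div]
  exact div_le_div₀ zero_le_one (captured_le_one _ _) hα hφ

theorem ipwWeight_mul_self {S : Type*} {φ : S → ℝ} (x : S × ℝ × ℝ) :
    ipwWeight φ x * ipwWeight φ x = ipwWeight φ x / φ x.1 := by
  rw [ipwWeight, div_mul_div_comm, captured_mul_self, div_div]

namespace CaptureRecapture

variable {S Ω' : Type*} [MeasurableSpace S] [MeasurableSpace Ω'] {ν : Measure Ω'}
  {Z : Ω' → S} {D₁ D₂ : Ω' → ℝ} {α₁₀ α₂₀ : ℝ} {π : S → ℝ}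

theorem measurable_inclusionProb (h : CaptureRecapture ν Z D₁ D₂ α₁₀ α₂₀ π) :
    Measurable (inclusionProb α₁₀ π) := by
  have := h.measurable_π
  unfold inclusionProb
  fun_prop

theorem measurable_observation (h : CaptureRecapture ν Z D₁ D₂ α₁₀ α₂₀ π) :
    Measurable fun ω => (Z ω, D₁ ω, D₂ ω) :=
  h.measurable_Z.prodMk (h.measurable_D₁.prodMk h.measurable_D₂)

theorem le_inclusionProb (h : CaptureRecapture ν Z D₁ D₂ α₁₀ α₂₀ π) (hα : α₁₀ ≤ 1) (z : S) :
    α₁₀ ≤ inclusionProb α₁₀ π z :=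
  _root_.le_inclusionProb hα (h.π_mem z).1

theorem inclusionProb_le_one (h : CaptureRecapture ν Z D₁ D₂ α₁₀ α₂₀ π) (hα : α₁₀ ≤ 1) (z : S) :
    inclusionProb α₁₀ π z ≤ 1 :=
  _root_.inclusionProb_le_one hα (h.π_mem z).2

theorem norm_ipwWeight_le (h : CaptureRecapture ν Z D₁ D₂ α₁₀ α₂₀ π)
    (hα : α₁₀ ∈ Set.Ioo (0 : ℝ) 1) (x : S × ℝ × ℝ) :
    ‖ipwWeight (inclusionProb α₁₀ π) x‖ ≤ α₁₀⁻¹ := by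
  rw [Real.norm_of_nonneg (ipwWeight_nonneg (hα.1.le.trans (h.le_inclusionProb hα.2.le _)))]
  exact ipwWeight_le hα.1 (h.le_inclusionProb hα.2.le _)

variable [IsProbabilityMeasure ν]

/-- The conditional probability given `Z` of being captured at least once is `φ(Z)`, by inclusion
and exclusion. -/
theorem condExp_captured (h : CaptureRecapture ν Z D₁ D₂ α₁₀ α₂₀ π) :
    ν[fun ω => captured (D₁ ω) (D₂ ω) | MeasurableSpace.comap Z inferInstance]
      =ᵐ[ν] fun ω => inclusionProb α₁₀ π (Z ω) := by
  have hb : ∀ {D : Ω' → ℝ}, Measurable D → (∀ᵐ ω ∂ν, D ω = 0 ∨ D ω = 1) → Integrable D ν := by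
    intro D hD hD01
    refine Integrable.of_bound hD.aestronglyMeasurable 1 ?_
    filter_upwards [hD01] with ω hω
    rcases hω with hω | hω <;> simp [hω]
  have h₁ := hb h.measurable_D₁ h.D₁_zero_or_one
  have h₂ := hb h.measurable_D₂ h.D₂_zero_or_one
  have h₁₂ : Integrable (fun ω => D₁ ω * D₂ ω) ν := by
    refine hb (h.measurable_D₁.mul h.measurable_D₂) ?_
    filter_upwards [h.D₁_zero_or_one, h.D₂_zero_or_one] with ω hω₁ hω₂
    rcases hω₁ with hω₁ | hω₁ <;> rcases hω₂ with hω₂ | hω₂ <;> simp [hω₁, hω₂]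
  have hC : (fun ω => captured (D₁ ω) (D₂ ω)) =ᵐ[ν] (D₁ + D₂) - fun ω => D₁ ω * D₂ ω := by
    filter_upwards [h.D₁_zero_or_one, h.D₂_zero_or_one] with ω hω₁ hω₂
    exact captured_eq_add_sub_mul hω₁ hω₂
  filter_upwards [condExp_congr_ae (m := MeasurableSpace.comap Z inferInstance) hC,
    condExp_sub (h₁.add h₂) h₁₂ (MeasurableSpace.comap Z inferInstance),
    condExp_add h₁ h₂ (MeasurableSpace.comap Z inferInstance), h.condExp_D₁, h.condExp_D₂,
    h.condExp_mul] with ω e₁ e₂ e₃ e₄ e₅ e₆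
  rw [e₁, e₂, Pi.sub_apply, e₃, Pi.add_apply, e₆, e₄, e₅, inclusionProb]
  ring

/-- Inverse-probability weighting is unbiased. -/
theorem integral_ipwWeight_mul (h : CaptureRecapture ν Z D₁ D₂ α₁₀ α₂₀ π)
    (hα : α₁₀ ∈ Set.Ioo (0 : ℝ) 1) {k : S → ℝ} (hk : Measurable k)
    (hki : Integrable (fun ω => k (Z ω)) ν) :
    ∫ ω, ipwWeight (inclusionProb α₁₀ π) (Z ω, D₁ ω, D₂ ω) * k (Z ω) ∂ν = ∫ ω, k (Z ω) ∂ν := by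
  set φ := inclusionProb α₁₀ π with hφ
  have hm : MeasurableSpace.comap Z inferInstance ≤ ‹MeasurableSpace Ω'› :=
    h.measurable_Z.comap_le
  have hCmeas : Measurable fun ω => captured (D₁ ω) (D₂ ω) :=
    measurable_captured.comp (h.measurable_D₁.prodMk h.measurable_D₂)
  have hCi : Integrable (fun ω => captured (D₁ ω) (D₂ ω)) ν :=
    Integrable.of_bound hCmeas.aestronglyMeasurable 1 (ae_of_all _ fun ω => by
      rw [Real.norm_of_nonneg (captured_nonneg _ _)]
      exact captured_le_one _ _)
  have hpos : ∀ z, φ z ≠ 0 := fun z => (hα.1.trans_le (h.le_inclusionProb hα.2.le z)).ne'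
  have hkφ : StronglyMeasurable[MeasurableSpace.comap Z inferInstance]
      fun ω => k (Z ω) / φ (Z ω) :=
    ((hk.div h.measurable_inclusionProb).comp (comap_measurable Z)).stronglyMeasurable
  have hrw : ∀ ω, ipwWeight φ (Z ω, D₁ ω, D₂ ω) * k (Z ω)
      = captured (D₁ ω) (D₂ ω) * (k (Z ω) / φ (Z ω)) := by
    intro ω
    simp only [ipwWeight]
    ring
  have hprod : Integrable (fun ω => captured (D₁ ω) (D₂ ω) * (k (Z ω) / φ (Z ω))) ν := by
    simp_rw [← hrw]
    exact hki.bdd_mul ((measurable_ipwWeight h.measurable_inclusionProb).comp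
      h.measurable_observation).aestronglyMeasurable
      (ae_of_all _ fun ω => h.norm_ipwWeight_le hα _)
  simp_rw [hrw]
  rw [← integral_condExp hm]
  refine integral_congr_ae ?_
  filter_upwards [condExp_mul_of_stronglyMeasurable_right hkφ hprod hCi, h.condExp_captured]
    with ω e₁ e₂
  refine e₁.trans ?_
  rw [Pi.mul_apply, e₂, ← hφ, mul_div_cancel₀ _ (hpos _)]

/-- The second moment of the weight given `Z` is `1 / φ(Z)`. -/
theorem integral_ipwWeight_sq_mul (h : CaptureRecapture ν Z D₁ D₂ α₁₀ α₂₀ π)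
    (hα : α₁₀ ∈ Set.Ioo (0 : ℝ) 1) {k : S → ℝ} (hk : Measurable k)
    (hki : Integrable (fun ω => k (Z ω) / inclusionProb α₁₀ π (Z ω)) ν) :
    ∫ ω, ipwWeight (inclusionProb α₁₀ π) (Z ω, D₁ ω, D₂ ω)
      * ipwWeight (inclusionProb α₁₀ π) (Z ω, D₁ ω, D₂ ω) * k (Z ω) ∂ν
      = ∫ ω, k (Z ω) / inclusionProb α₁₀ π (Z ω) ∂ν := by
  refine Eq.trans ?_ (h.integral_ipwWeight_mul hα (hk.div h.measurable_inclusionProb) hki)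
  simp_rw [ipwWeight_mul_self, Pi.div_apply, div_mul_eq_mul_div, mul_div_assoc]

end CaptureRecapture

/-! ### A measurable version of the score -/

/-- The score is a limit of difference quotients, hence it is almost surely a measurable function
of the datum. -/
theorem exists_measurable_score {S Ω' : Type*} {q : ℕ} [MeasurableSpace S] [MeasurableSpace Ω']
    {ν : Measure Ω'} {Z : Ω' → S} (hZ : Measurable Z)
    {ℓ : S → EuclideanSpace ℝ (Fin q) → ℝ} {θ₀ : EuclideanSpace ℝ (Fin q)}
    {ℓ' : S → EuclideanSpace ℝ (Fin q)} (hℓ : ∀ θ, Measurable fun z => ℓ z θ)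
    (hscore : ∀ᵐ ω ∂ν, HasGradientAt (ℓ (Z ω)) (ℓ' (Z ω)) θ₀) :
    ∃ g : S → EuclideanSpace ℝ (Fin q), Measurable g ∧ ∀ᵐ ω ∂ν, g (Z ω) = ℓ' (Z ω) := by
  let F : Fin q → ℕ → S → ℝ := fun j n z =>
    (n : ℝ) • (ℓ z (θ₀ + (n : ℝ)⁻¹ • EuclideanSpace.single j 1) - ℓ z θ₀)
  have hF : ∀ j n, Measurable (F j n) := fun j n =>
    ((hℓ _).sub (hℓ _)).const_smul (n : ℝ)
  have hlim : ∀ᵐ ω ∂ν, ∀ j, Tendsto (fun n => F j n (Z ω)) atTop (𝓝 (ℓ' (Z ω) j)) := by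
    filter_upwards [hscore] with ω hω j
    have h := hω.hasFDerivAt.lim (EuclideanSpace.single j 1) (c := fun n : ℕ => (n : ℝ))
      (l := atTop) (by simpa using tendsto_natCast_atTop_atTop)
    simpa [F, EuclideanSpace.inner_single_right] using h
  have hex : ∀ j, ∃ g : S → ℝ, Measurable g ∧
      ∀ᵐ z ∂ν.map Z, Tendsto (fun n => F j n z) atTop (𝓝 (g z)) := by
    intro j
    refine measurable_limit_of_tendsto_metrizable_ae (fun n => (hF j n).aemeasurable) ?_
    rw [ae_map_iff hZ.aemeasurable (measurableSet_exists_tendsto (hF j))]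
    filter_upwards [hlim] with ω hω using ⟨_, hω j⟩
  choose g hg hglim using hex
  refine ⟨fun z => WithLp.toLp 2 fun j => g j z, by fun_prop, ?_⟩
  filter_upwards [hlim, ae_all_iff.2 fun j => ae_of_ae_map hZ.aemeasurable (hglim j)]
    with ω h₁ h₂
  ext j
  exact tendsto_nhds_unique (h₂ j) (h₁ j)

/-! ### The weighted loss -/

theorem lossRemainder_weighted {S : Type*} {q : ℕ} (φ : S → ℝ)
    (ℓ : S → EuclideanSpace ℝ (Fin q) → ℝ) (θ₀ : EuclideanSpace ℝ (Fin q))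
    (g : S → EuclideanSpace ℝ (Fin q)) (x : S × ℝ × ℝ) (t : EuclideanSpace ℝ (Fin q)) :
    lossRemainder (fun x θ => ipwWeight φ x * ℓ x.1 θ) θ₀ (fun x => ipwWeight φ x • g x.1) x t
      = ipwWeight φ x * lossRemainder ℓ θ₀ g x.1 t := by
  simp only [lossRemainder, real_inner_smul_left]
  ring

theorem ipwRisk_eq_sum_ipwWeight_mul {S : Type*} {q : ℕ} (φ : S → ℝ)
    (ℓ : S → EuclideanSpace ℝ (Fin q) → ℝ) (N : ℕ) (z : ℕ → S) (d₁ d₂ : ℕ → ℝ)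
    (θ : EuclideanSpace ℝ (Fin q)) :
    ipwRisk φ ℓ N z d₁ d₂ θ
      = 1 / (N : ℝ) * ∑ i ∈ Finset.range N, ipwWeight φ (z i, d₁ i, d₂ i) * ℓ (z i) θ := rfl

/-- For nonempty samples, minimizing the IPW risk is minimizing the weighted sum of losses. -/
theorem IsIPWEstimator.eventually_minimizes {S Ω : Type*} {q : ℕ} [MeasurableSpace Ω]
    {μ : Measure Ω} {Zs : ℕ → Ω → S} {D₁s D₂s : ℕ → Ω → ℝ} {φ : S → ℝ}
    {ℓ : S → EuclideanSpace ℝ (Fin q) → ℝ} {θhat : ℕ → Ω → EuclideanSpace ℝ (Fin q)}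
    (h : IsIPWEstimator μ Zs D₁s D₂s φ ℓ θhat) :
    ∀ᶠ N in atTop, ∀ᵐ ω ∂μ,
      (∃ θ, ∀ θ',
        ∑ i ∈ Finset.range N, ipwWeight φ (Zs i ω, D₁s i ω, D₂s i ω) * ℓ (Zs i ω) θ
          ≤ ∑ i ∈ Finset.range N, ipwWeight φ (Zs i ω, D₁s i ω, D₂s i ω) * ℓ (Zs i ω) θ') →
      ∀ θ',
        ∑ i ∈ Finset.range N, ipwWeight φ (Zs i ω, D₁s i ω, D₂s i ω) * ℓ (Zs i ω) (θhat N ω)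
          ≤ ∑ i ∈ Finset.range N, ipwWeight φ (Zs i ω, D₁s i ω, D₂s i ω) * ℓ (Zs i ω) θ' := by
  filter_upwards [eventually_ge_atTop 1] with N hN
  have hpos : (0 : ℝ) < 1 / N := by positivity
  filter_upwards [h.minimizes N] with ω hω
  simpa only [ipwRisk_eq_sum_ipwWeight_mul, mul_le_mul_iff_right₀ hpos] using hω

namespace CaptureRecapture

variable {S Ω' : Type*} {q : ℕ} [MeasurableSpace S] [MeasurableSpace Ω'] {ν : Measure Ω'}
  {Z : Ω' → S} {D₁ D₂ : Ω' → ℝ} {α₁₀ α₂₀ : ℝ} {π : S → ℝ} {g : S → EuclideanSpace ℝ (Fin q)}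

theorem integrable_score_mul_score (h : CaptureRecapture ν Z D₁ D₂ α₁₀ α₂₀ π)
    (hα : α₁₀ ∈ Set.Ioo (0 : ℝ) 1)
    (hB : ∀ j k, Integrable (fun ω => g (Z ω) j * g (Z ω) k / inclusionProb α₁₀ π (Z ω)) ν)
    (j k : Fin q) : Integrable (fun ω => g (Z ω) j * g (Z ω) k) ν := by
  have hpos : ∀ z, inclusionProb α₁₀ π z ≠ 0 :=
    fun z => (hα.1.trans_le (h.le_inclusionProb hα.2.le z)).ne'
  have h₁ : Integrable (fun ω => inclusionProb α₁₀ π (Z ω)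
      * (g (Z ω) j * g (Z ω) k / inclusionProb α₁₀ π (Z ω))) ν := by
    refine (hB j k).bdd_mul (c := 1)
      (h.measurable_inclusionProb.comp h.measurable_Z).aestronglyMeasurable
      (ae_of_all _ fun ω => ?_)
    rw [Real.norm_of_nonneg (hα.1.le.trans (h.le_inclusionProb hα.2.le _))]
    exact h.inclusionProb_le_one hα.2.le _
  simpa only [mul_div_cancel₀ _ (hpos _)] using h₁

theorem integrable_ipwWeight_mul (h : CaptureRecapture ν Z D₁ D₂ α₁₀ α₂₀ π)
    (hα : α₁₀ ∈ Set.Ioo (0 : ℝ) 1) {k : Ω' → ℝ} (hk : Integrable k ν) :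
    Integrable (fun ω => ipwWeight (inclusionProb α₁₀ π) (Z ω, D₁ ω, D₂ ω) * k ω) ν :=
  hk.bdd_mul ((measurable_ipwWeight h.measurable_inclusionProb).comp
    h.measurable_observation).aestronglyMeasurable (ae_of_all _ fun _ => h.norm_ipwWeight_le hα _)

theorem memLp_ipwWeight_mul (h : CaptureRecapture ν Z D₁ D₂ α₁₀ α₂₀ π)
    (hα : α₁₀ ∈ Set.Ioo (0 : ℝ) 1) {k : Ω' → ℝ} (hk : MemLp k 2 ν) :
    MemLp (fun ω => ipwWeight (inclusionProb α₁₀ π) (Z ω, D₁ ω, D₂ ω) * k ω) 2 ν := by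
  refine MemLp.of_le_mul hk (c := α₁₀⁻¹) (((measurable_ipwWeight h.measurable_inclusionProb).comp
    h.measurable_observation).aestronglyMeasurable.mul hk.1) (ae_of_all _ fun ω => ?_)
  rw [norm_mul]
  exact mul_le_mul_of_nonneg_right (h.norm_ipwWeight_le hα _) (norm_nonneg _)

end CaptureRecapture

theorem theorem1 {S Ω Ω' : Type*} [MeasurableSpace S] [MeasurableSpace Ω] [MeasurableSpace Ω']
    (μ : Measure Ω) [IsProbabilityMeasure μ] (ν : Measure Ω') [IsProbabilityMeasure ν]
    (q : ℕ) (Z : Ω' → S) (D₁ D₂ : Ω' → ℝ) (Zs : ℕ → Ω → S) (D₁s D₂s : ℕ → Ω → ℝ)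
    (α₁₀ α₂₀ : ℝ) (π : S → ℝ)
    (ℓ : S → EuclideanSpace ℝ (Fin q) → ℝ) (θ₀ : EuclideanSpace ℝ (Fin q))
    (ℓ' : S → EuclideanSpace ℝ (Fin q)) (V : Matrix (Fin q) (Fin q) ℝ)
    (θhat : ℕ → Ω → EuclideanSpace ℝ (Fin q))
    (hα₁₀ : α₁₀ ∈ Set.Ioo (0 : ℝ) 1) (hα₂₀ : α₂₀ ∈ Set.Ioo (0 : ℝ) 1)
    (hsampling : CaptureRecapture ν Z D₁ D₂ α₁₀ α₂₀ π)
    (hiid : IIDCopies μ Zs D₁s D₂s ν Z D₁ D₂)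
    (hθ₀ : IsRiskMinimizer ν Z ℓ θ₀)
    (hloss : ConvexLossExpansion ν Z (inclusionProb α₁₀ π) ℓ θ₀ ℓ' V)
    (hθhat : IsIPWEstimator μ Zs D₁s D₂s (inclusionProb α₁₀ π) ℓ θhat) :
    TendstoInDistribution (fun (N : ℕ) (ω : Ω) => Real.sqrt (N : ℝ) • (θhat N ω - θ₀)) atTop
      (id : EuclideanSpace ℝ (Fin q) → EuclideanSpace ℝ (Fin q)) (fun _ => μ)
      (multivariateGaussian 0
        (V⁻¹ * weightedScoreMatrix ν Z (inclusionProb α₁₀ π) ℓ' * V⁻¹)) := by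
  set φ := inclusionProb α₁₀ π with hφ
  -- `ℓ'` need not be measurable on `S`, so it cannot be evaluated on the sample; it is replaced by
  -- a measurable function `g` with `g (Z) = ℓ' (Z)` almost surely.
  obtain ⟨g, hg, hgℓ'⟩ := exists_measurable_score hsampling.measurable_Z hloss.measurable_loss
    hloss.score
  have hφm : Measurable φ := hsampling.measurable_inclusionProb
  have hw : Measurable (ipwWeight φ) := measurable_ipwWeight hφm
  have hW : Measurable fun ω => (Z ω, D₁ ω, D₂ ω) := hsampling.measurable_observation
  have hgj : ∀ j, Measurable fun z => g z j := fun j => by fun_prop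
  have hR : ∀ t, Measurable fun z => lossRemainder ℓ θ₀ g z t := by
    intro t
    have h₁ := hloss.measurable_loss (θ₀ + t)
    have h₂ := hloss.measurable_loss θ₀
    unfold lossRemainder
    fun_prop
  have hRae : ∀ t, (fun ω => lossRemainder ℓ θ₀ g (Z ω) t)
      =ᵐ[ν] fun ω => lossRemainder ℓ θ₀ ℓ' (Z ω) t := by
    intro t
    filter_upwards [hgℓ'] with ω hω
    simp only [lossRemainder, hω]
  have hR2 : ∀ᶠ t in 𝓝 0, MemLp (fun ω => lossRemainder ℓ θ₀ g (Z ω) t) 2 ν := by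
    filter_upwards [hloss.memLp_remainder] with t ht using ht.ae_eq (hRae t).symm
  have hggae : ∀ j k, (fun ω => g (Z ω) j * g (Z ω) k / φ (Z ω))
      =ᵐ[ν] fun ω => ℓ' (Z ω) j * ℓ' (Z ω) k / φ (Z ω) := by
    intro j k
    filter_upwards [hgℓ'] with ω hω
    rw [hω]
  have hggφ : ∀ j k, Integrable (fun ω => g (Z ω) j * g (Z ω) k / φ (Z ω)) ν := fun j k =>
    (hloss.finite_B j k).congr (hggae j k).symm
  have hgg := hsampling.integrable_score_mul_score hα₁₀ hggφ
  have hgi : Integrable (fun ω => g (Z ω)) ν :=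
    hloss.integrable_score.congr (hgℓ'.mono fun ω hω => hω.symm)
  have hgij : ∀ j, Integrable (fun ω => g (Z ω) j) ν := integrable_piLp_iff.1 hgi
  have hmap : ∀ {k : S × ℝ × ℝ → ℝ}, Measurable k →
      ∫ x, k x ∂ν.map (fun ω => (Z ω, D₁ ω, D₂ ω)) = ∫ ω, k (Z ω, D₁ ω, D₂ ω) ∂ν := fun hk =>
    integral_map hW.aemeasurable hk.aestronglyMeasurable
  have hwgg : ∀ j k, ∀ x : S × ℝ × ℝ, (ipwWeight φ x • g x.1) j * (ipwWeight φ x • g x.1) k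
      = ipwWeight φ x * ipwWeight φ x * (g x.1 j * g x.1 k) := by
    intro j k x
    simp only [PiLp.smul_apply, smul_eq_mul]
    ring
  have hwRm : ∀ t, Measurable fun x : S × ℝ × ℝ => ipwWeight φ x * lossRemainder ℓ θ₀ g x.1 t :=
    fun t => hw.mul ((hR t).comp measurable_fst)
  refine tendstoInDistribution_sqrt_smul_minimizer_sub
    (X := fun i ω => (Zs i ω, D₁s i ω, D₂s i ω)) (ρ := ν.map fun ω => (Z ω, D₁ ω, D₂ ω))
    (f := fun x θ => ipwWeight φ x * ℓ x.1 θ) (g := fun x => ipwWeight φ x • g x.1)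
    hiid.indep (fun i => ⟨(hiid.identDistrib i).aemeasurable_fst, (hiid.identDistrib i).map_eq⟩)
    (fun θ => hw.mul ((hloss.measurable_loss θ).comp measurable_fst)) (fun x => ?_)
    (hw.smul (hg.comp measurable_fst)) ?_ ?_ (fun j k => ?_) (fun j k => ?_) hloss.posDef
    ?_ ?_ ?_ hθhat.aemeasurable hθhat.eventually_minimizes
  · exact (hloss.convex x.1).smul
      (ipwWeight_nonneg (hα₁₀.1.le.trans (hsampling.le_inclusionProb hα₁₀.2.le _)))
  · refine (memLp_map_measure_iff (hw.smul (hg.comp measurable_fst)).aestronglyMeasurable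
      hW.aemeasurable).2 (memLp_piLp_iff.2 fun j =>
        hsampling.memLp_ipwWeight_mul hα₁₀ (k := fun ω => g (Z ω) j) ?_)
    refine (memLp_two_iff_integrable_sq (hgij j).1).2 ?_
    simpa only [sq] using hgg j j
  · have hint : ∀ j, Integrable (fun x : S × ℝ × ℝ => (ipwWeight φ x • g x.1) j)
        (ν.map fun ω => (Z ω, D₁ ω, D₂ ω)) := fun j =>
      (integrable_map_measure (hw.mul ((hgj j).comp measurable_fst)).aestronglyMeasurable
        hW.aemeasurable).2 (hsampling.integrable_ipwWeight_mul hα₁₀ (hgij j))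
    ext j
    rw [eval_integral_piLp hint]
    refine (hmap (hw.mul ((hgj j).comp measurable_fst))).trans ?_
    refine (hsampling.integral_ipwWeight_mul hα₁₀ (hgj j) (hgij j)).trans ?_
    rw [← eval_integral_piLp hgij, integral_congr_ae hgℓ', hloss.integral_score]
  · simp_rw [hwgg]
    refine (integrable_map_measure ((hw.mul hw).mul
      (((hgj j).mul (hgj k)).comp measurable_fst)).aestronglyMeasurable hW.aemeasurable).2 ?_
    simpa only [Function.comp_def, Pi.mul_apply, mul_assoc] using
      hsampling.integrable_ipwWeight_mul hα₁₀ (hsampling.integrable_ipwWeight_mul hα₁₀ (hgg j k))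
  · simp_rw [hwgg]
    refine (hmap ((hw.mul hw).mul (((hgj j).mul (hgj k)).comp measurable_fst))).trans ?_
    refine (hsampling.integral_ipwWeight_sq_mul hα₁₀ ((hgj j).mul (hgj k)) (hggφ j k)).trans ?_
    exact integral_congr_ae (hggae j k)
  · simp_rw [lossRemainder_weighted]
    filter_upwards [hR2] with t ht
    exact (memLp_map_measure_iff (hwRm t).aestronglyMeasurable hW.aemeasurable).2
      (hsampling.memLp_ipwWeight_mul hα₁₀ ht)
  · refine hloss.mean_remainder.congr' ?_ EventuallyEq.rfl
    filter_upwards [hR2] with t ht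
    simp_rw [lossRemainder_weighted]
    rw [hmap (hwRm t), hsampling.integral_ipwWeight_mul hα₁₀ (hR t)
      (ht.integrable (by norm_num)), integral_congr_ae (hRae t)]
  · -- The weights are bounded by `1 / α₁₀`, so they do not change the order of the second moment.
    refine IsBigO.trans_isLittleO ?_ hloss.sq_remainder
    refine IsBigO.of_bound (α₁₀⁻¹ ^ 2) ?_
    filter_upwards [hR2] with t ht
    simp_rw [lossRemainder_weighted]
    have hsq : ∫ ω, lossRemainder ℓ θ₀ ℓ' (Z ω) t ^ 2 ∂ν
        = ∫ ω, lossRemainder ℓ θ₀ g (Z ω) t ^ 2 ∂ν :=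
      integral_congr_ae ((hRae t).symm.mono fun ω hω => by simp only [hω])
    rw [hmap ((hwRm t).pow_const 2), hsq,
      Real.norm_of_nonneg (integral_nonneg fun _ => sq_nonneg _),
      Real.norm_of_nonneg (integral_nonneg fun _ => sq_nonneg _), ← integral_const_mul]
    refine integral_mono (hsampling.memLp_ipwWeight_mul hα₁₀ ht).integrable_sq
      (ht.integrable_sq.const_mul _) fun ω => ?_
    simp only [mul_pow]
    refine mul_le_mul_of_nonneg_right ?_ (sq_nonneg _)
    rw [← sq_abs]
    exact pow_le_pow_left₀ (abs_nonneg _) (hsampling.norm_ipwWeight_le hα₁₀ _) 2
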